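/- All graphs are simple and $F$ is finite. A graph homomorphism $\phi : F \to H$ is \emph{locally injective} if for every $v \in V(F)$ the restriction of $\phi$ to the neighborhood of $v$ is injective. Let $\mathcal L_F$ be the family of all graphs $H$ for which there is a locally injective homomorphism from $F$ to $H$. A graph is $\mathcal L_F$-free if no subgraph of it belongs to $\mathcal L_F$, and $\mathrm{ex}(n,\mathcal L_F)$ is the maximum number of edges of an $\mathcal L_F$-free graph on $n$ vertices. Write $H \xrightarrow{s} F$ if every coloring of the edges of $H$ with $s$ colors contains a monochromatic (not necessarily induced) subgraph isomorphic to $F$, and let the degree Ramsey number $R_\Delta(F,s)$ be the minimum of the maximum degree $\Delta(H)$ over all finite graphs $H$ with $H \xrightarrow{s} F$. Theorem. Let $F$ be a fixed finite graph that contains at least one cycle, and let $\eta$ be a real number such that $\mathrm{ex}(n,\mathcal L_F)=\Omega(n^{1+\eta})$ as $n\to\infty$. (i) If $\eta<1$, then $$R_\Delta(F,s)=\Omega\left(\left(\frac{s}{\log s}\right)^{\frac{1}{1-\eta}}\right)\qquad (s\to\infty).$$ (ii) If $\eta=1$, then $R_\Delta(F,s)=2^{\Omega(s^{1/4})}$ as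 $s\to\infty$; that is, there is a constant $c>0$ such that $R_\Delta(F,s)\ge 2^{c s^{1/4}}$ for all sufficiently large integers $s$. The implied constants may depend on $F$, on $\eta$, and on the constant implied in the hypothesis. -/

import Mathlib

open Filter Asymptotics

namespace DegreeRamsey

/-- A graph homomorphism is locally injective if its restriction to the neighborhood of every
vertex is injective. -/
def IsLocallyInjective {V W : Type*} {F : SimpleGraph V} {H : SimpleGraph W} (φ : F →g H) : Prop :=
  ∀ v : V, Set.InjOn φ (F.neighborSet v)

/-- Membership of `H` in the family `𝓛_F` of all graphs that admit a locally injective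
homomorphism from `F`. -/
def InLocInjFamily {V W : Type*} (F : SimpleGraph V) (H : SimpleGraph W) : Prop :=
  ∃ φ : F →g H, IsLocallyInjective φ

/-- `G` is `𝓛_F`-free: no subgraph of `G` is a member of the family `𝓛_F`. -/
def LocInjFree {V W : Type*} (F : SimpleGraph V) (G : SimpleGraph W) : Prop :=
  ∀ H : G.Subgraph, ¬ InLocInjFamily F H.coe

open scoped Classical in
/-- The Turán number `ex(n, 𝓛_F)`: the maximum number of edges of an `𝓛_F`-free graph on `n`
vertices. -/
noncomputable def exLocInj {V : Type*} (F : SimpleGraph V) (n : ℕ) : ℕ :=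
  Finset.sup {G : SimpleGraph (Fin n) | LocInjFree F G} (fun G => G.edgeFinset.card)

/-- `H ⟶ₛ F`: every coloring of the edges of `H` with `s` colors has a color class that contains
a copy of `F` (as a not necessarily induced subgraph). -/
def Arrows {V W : Type*} (H : SimpleGraph W) (s : ℕ) (F : SimpleGraph V) : Prop :=
  ∀ c : H.EdgeLabeling (Fin s), ∃ i : Fin s, F.IsContained (c.labelGraph i)

open scoped Classical in
/-- The degree Ramsey number `R_Δ(F, s)`: the minimum of the maximum degrees `Δ(H)` of the finite
graphs `H` with `H ⟶ₛ F`. -/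
noncomputable def degreeRamsey {V : Type*} (F : SimpleGraph V) (s : ℕ) : ℕ :=
  sInf {d : ℕ | ∃ (n : ℕ) (H : SimpleGraph (Fin n)), Arrows H s F ∧ H.maxDegree = d}

end DegreeRamsey

namespace DegreeRamsey

/-! Let `H` have maximum degree below `D`, and let `G` be an extremal `𝓛_F`-free graph on `n = K *
D` vertices, `K` constant. Take `s` independent uniform maps `χᵢ : V(H) → V(G)`, and allow colour
`i` on the edge `uv` when `χᵢ` sends `uv` to an edge of `G` and no other neighbour of `u` or `v`
shares an image with `u` or `v`. The allowed edges form `pulledBack`. On it `χᵢ` is locally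
injective, so a copy of `F` there would put a member of `𝓛_F` inside `G`.

Since `n ≥ 8 * D`, collisions cost only a constant factor, and an edge is allowed in a given colour
with probability at least `p = e(G) / n ^ 2`, of order at least `D ^ (η - 1)`. It has no allowed
colour with probability at most `(1 - p) ^ s`. These bad events depend only on nearby edges, so the
local lemma makes all of them fail once `s ≥ C * D ^ (1 - η) * log D`; hence `H` does not arrow `F`.
Taking `D = 3 * R_Δ(F, s)` and inverting gives both bounds; for `η = 1` the exponent obtained is
even linear in `s`. -/

/-! ### Local lemma and independence, by counting -/

open scoped Classical in
/-- The inductive estimate behind the symmetric Lovász local lemma, in counting form. -/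
theorem card_event_and_avoid_le {Ω ι : Type*} [Fintype Ω] (A : ι → Ω → Prop)
    (N : ι → Finset ι) (p : ℝ) (d : ℕ) (hp : 0 ≤ p) (hpd : 4 * p * d ≤ 1)
    (hN : ∀ i, (N i).card ≤ d)
    (hindep : ∀ (i : ι) (S : Finset ι), Disjoint S (N i) →
      (Finset.card {ω : Ω | A i ω ∧ ∀ j ∈ S, ¬ A j ω} : ℝ) ≤
        p * (Finset.card {ω : Ω | ∀ j ∈ S, ¬ A j ω} : ℝ))
    (S : Finset ι) (i : ι) (hi : i ∉ S) :
    (Finset.card {ω : Ω | A i ω ∧ ∀ j ∈ S, ¬ A j ω} : ℝ) ≤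
      2 * p * (Finset.card {ω : Ω | ∀ j ∈ S, ¬ A j ω} : ℝ) := by
  induction S using Finset.strongInduction generalizing i with
  | H S ih =>
  -- Independence applies to the events in `S₂`. Restoring those in `S ∩ N i` loses at most half of
  -- the points avoiding `S₂`, by induction and `4 * p * d ≤ 1`; this is the factor 2.
  set S₂ := S \ N i with hS₂
  have hnum : (Finset.card {ω : Ω | A i ω ∧ ∀ j ∈ S, ¬ A j ω} : ℝ) ≤
      p * (Finset.card {ω : Ω | ∀ j ∈ S₂, ¬ A j ω} : ℝ) := by
    refine le_trans ?_ (hindep i S₂ Finset.sdiff_disjoint)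
    refine Nat.cast_le.2 (Finset.card_le_card fun ω hω => ?_)
    have h := (Finset.mem_filter.1 hω).2
    exact Finset.mem_filter.2
      ⟨Finset.mem_univ _, h.1, fun j hj => h.2 j (Finset.mem_sdiff.1 hj).1⟩
  have hden : (Finset.card {ω : Ω | ∀ j ∈ S₂, ¬ A j ω} : ℝ) ≤
      (Finset.card {ω : Ω | ∀ j ∈ S, ¬ A j ω} : ℝ) +
        ∑ k ∈ S ∩ N i, (Finset.card {ω : Ω | A k ω ∧ ∀ j ∈ S₂, ¬ A j ω} : ℝ) := by
    have hsub : ({ω : Ω | ∀ j ∈ S₂, ¬ A j ω} : Finset Ω) ⊆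
        ({ω : Ω | ∀ j ∈ S, ¬ A j ω} : Finset Ω) ∪
          (S ∩ N i).biUnion fun k => {ω : Ω | A k ω ∧ ∀ j ∈ S₂, ¬ A j ω} := by
      intro ω hω
      simp only [Finset.mem_union, Finset.mem_filter, Finset.mem_univ, true_and,
        Finset.mem_biUnion, Finset.mem_inter] at hω ⊢
      by_cases h : ∀ j ∈ S, ¬ A j ω
      · exact Or.inl h
      · push Not at h
        obtain ⟨j, hj, hAj⟩ := h
        refine Or.inr ⟨j, ⟨hj, ?_⟩, hAj, hω⟩
        by_contra hjN
        exact hω j (Finset.mem_sdiff.2 ⟨hj, hjN⟩) hAj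
    have h := (Finset.card_le_card hsub).trans (Finset.card_union_le _ _)
    have h' := h.trans (Nat.add_le_add_left Finset.card_biUnion_le _)
    exact_mod_cast h'
  have hsum : ∑ k ∈ S ∩ N i, (Finset.card {ω : Ω | A k ω ∧ ∀ j ∈ S₂, ¬ A j ω} : ℝ) ≤
      (1 / 2) * (Finset.card {ω : Ω | ∀ j ∈ S₂, ¬ A j ω} : ℝ) := by
    have hle : ∀ k ∈ S ∩ N i, (Finset.card {ω : Ω | A k ω ∧ ∀ j ∈ S₂, ¬ A j ω} : ℝ) ≤
        2 * p * (Finset.card {ω : Ω | ∀ j ∈ S₂, ¬ A j ω} : ℝ) := by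
      intro k hk
      obtain ⟨hkS, hkN⟩ := Finset.mem_inter.1 hk
      have hkS₂ : k ∉ S₂ := fun h => (Finset.mem_sdiff.1 h).2 hkN
      exact ih S₂ ⟨Finset.sdiff_subset, fun h => hkS₂ (h hkS)⟩ k hkS₂
    refine (Finset.sum_le_card_nsmul _ _ _ hle).trans ?_
    have hc : ((S ∩ N i).card : ℝ) ≤ d := by
      exact_mod_cast (Finset.card_le_card Finset.inter_subset_right).trans (hN i)
    rw [nsmul_eq_mul, ← mul_assoc]
    refine mul_le_mul_of_nonneg_right ?_ (Nat.cast_nonneg _)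
    nlinarith
  nlinarith

open scoped Classical in
/-- The symmetric Lovász local lemma, in counting form. -/
theorem exists_avoid_of_local {Ω ι : Type*} [Fintype Ω] [Nonempty Ω] (A : ι → Ω → Prop)
    (N : ι → Finset ι) (p : ℝ) (d : ℕ) (hp : 0 ≤ p) (hpd : 4 * p * d ≤ 1)
    (hd : 1 ≤ d) (hN : ∀ i, (N i).card ≤ d)
    (hindep : ∀ (i : ι) (S : Finset ι), Disjoint S (N i) →
      (Finset.card {ω : Ω | A i ω ∧ ∀ j ∈ S, ¬ A j ω} : ℝ) ≤
        p * (Finset.card {ω : Ω | ∀ j ∈ S, ¬ A j ω} : ℝ))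
    (S : Finset ι) : ∃ ω, ∀ j ∈ S, ¬ A j ω := by
  have hpos : 0 < (Finset.card {ω : Ω | ∀ j ∈ S, ¬ A j ω} : ℝ) := by
    induction S using Finset.induction_on with
    | empty => simp [Fintype.card_pos]
    | insert i S hi ih =>
      have hle := card_event_and_avoid_le A N p d hp hpd hN hindep S i hi
      have hsplit : (Finset.card {ω : Ω | ∀ j ∈ S, ¬ A j ω} : ℝ) =
          (Finset.card {ω : Ω | A i ω ∧ ∀ j ∈ S, ¬ A j ω} : ℝ) +
            (Finset.card {ω : Ω | ∀ j ∈ insert i S, ¬ A j ω} : ℝ) := by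
        rw [← Finset.card_filter_add_card_filter_not (s := {ω : Ω | ∀ j ∈ S, ¬ A j ω}) (A i)]
        push_cast
        congr 3
        · ext ω; simp [and_comm]
        · ext ω; simp [and_comm]
      -- With `p ≤ 1 / 4`, each new event removes at most half of the remaining points.
      have hd' : (1 : ℝ) ≤ d := by exact_mod_cast hd
      have hp4 : 4 * p ≤ 1 := by nlinarith
      nlinarith
  obtain ⟨ω, hω⟩ := Finset.card_pos.1 (by exact_mod_cast hpos)
  exact ⟨ω, (Finset.mem_filter.1 hω).2⟩

open scoped Classical in
/-- In a product space, events determined by disjoint sets of coordinates are independent. -/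
theorem card_and_mul_card_eq {W X : Type*} [Fintype W] [Fintype X] (T : Finset W)
    (A B : (W → X) → Prop)
    (hA : ∀ f g : W → X, (∀ w ∈ T, f w = g w) → A f → A g)
    (hB : ∀ f g : W → X, (∀ w ∉ T, f w = g w) → B f → B g) :
    Finset.card {f : W → X | A f ∧ B f} * Fintype.card (W → X) =
      Finset.card {f : W → X | A f} * Finset.card {f : W → X | B f} := by
  rw [← Finset.card_univ, ← Finset.card_product, ← Finset.card_product]
  -- Exchanging the coordinates outside `T` is an involution; it carries pairs with `A` and `B` on
  -- the first entry to pairs with `A` on the first and `B` on the second.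
  let σ : (W → X) × (W → X) → (W → X) × (W → X) := fun q =>
    (fun w => if w ∈ T then q.1 w else q.2 w, fun w => if w ∈ T then q.2 w else q.1 w)
  have hσ : ∀ q, σ (σ q) = q := by
    rintro ⟨f, g⟩
    simp only [σ, Prod.mk.injEq]
    constructor <;> ext w <;> by_cases hw : w ∈ T <;> simp [hw]
  refine Finset.card_bij' (fun q _ => σ q) (fun q _ => σ q) ?_ ?_
    (fun q _ => hσ q) (fun q _ => hσ q)
  · rintro ⟨f, g⟩ h
    simp only [Finset.mem_product, Finset.mem_filter, Finset.mem_univ, true_and, and_true] at h ⊢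
    exact ⟨hA f _ (fun w hw => by simp [σ, hw]) h.1, hB f _ (fun w hw => by simp [σ, hw]) h.2⟩
  · rintro ⟨f, g⟩ h
    simp only [Finset.mem_product, Finset.mem_filter, Finset.mem_univ, true_and, and_true] at h ⊢
    exact ⟨hA f _ (fun w hw => by simp [σ, hw]) h.1, hB g _ (fun w hw => by simp [σ, hw]) h.2⟩

/-! ### Finiteness of the degree Ramsey number -/

/-- Ramsey's theorem for `s` colours, off-diagonal form. -/
theorem exists_monochromatic_clique {s : ℕ} (hs : 0 < s) (m : ℕ) (k : Fin s → ℕ)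
    (hk : ∑ i, k i = m) :
    ∃ N : ℕ, ∀ {W : Type} (c : W → W → Fin s), (∀ x y, c x y = c y x) →
      ∀ A : Finset W, N ≤ A.card →
        ∃ i, ∃ B ⊆ A, B.card = k i ∧ ∀ x ∈ B, ∀ y ∈ B, x ≠ y → c x y = i := by
  induction m generalizing k with
  | zero =>
    refine ⟨0, fun c _ A _ => ⟨⟨0, hs⟩, ∅, by simp, ?_, by simp⟩⟩
    exact ((Finset.sum_eq_zero_iff.1 hk) _ (Finset.mem_univ _)).symm
  | succ m ih =>
    classical
    by_cases h0 : ∃ i, k i = 0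
    · obtain ⟨i, hi⟩ := h0
      exact ⟨0, fun c _ A _ => ⟨i, ∅, by simp, by simp [hi], by simp⟩⟩
    push Not at h0
    have hpred : ∀ i, ∑ j, Function.update k i (k i - 1) j = m := by
      intro i
      rw [Finset.sum_update_of_mem (Finset.mem_univ i)]
      rw [Finset.sum_eq_add_sum_sdiff_singleton_of_mem (Finset.mem_univ i)] at hk
      have := h0 i
      omega
    choose N hN using fun i => ih (Function.update k i (k i - 1)) (hpred i)
    -- One point `x`, plus enough others for pigeonhole to give `N i` of them joined to `x` in some
    -- colour `i`.
    refine ⟨∑ i, N i + 1, fun {W} c hc A hA => ?_⟩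
    obtain ⟨x, hx⟩ : A.Nonempty := Finset.card_pos.1 (by omega)
    obtain ⟨i, hi⟩ : ∃ i, N i ≤ ((A.erase x).filter fun y => c x y = i).card := by
      by_contra! hlt
      have hsum : (A.erase x).card = ∑ i, ((A.erase x).filter fun y => c x y = i).card :=
        Finset.card_eq_sum_card_fiberwise (fun _ _ => Finset.mem_univ _)
      have hle : ∑ i, ((A.erase x).filter fun y => c x y = i).card < ∑ i, N i :=
        Finset.sum_lt_sum_of_nonempty ⟨⟨0, hs⟩, Finset.mem_univ _⟩ fun i _ => hlt i
      rw [Finset.card_erase_of_mem hx] at hsum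
      omega
    obtain ⟨j, B, hBA, hBc, hB⟩ := hN i c hc _ hi
    by_cases hij : j = i
    · subst hij
      have hBx : ∀ y ∈ B, y ≠ x ∧ y ∈ A ∧ c x y = j := fun y hy => by
        have := hBA hy
        simp only [Finset.mem_filter, Finset.mem_erase] at this
        exact ⟨this.1.1, this.1.2, this.2⟩
      refine ⟨j, insert x B, ?_, ?_, ?_⟩
      · exact Finset.insert_subset hx fun y hy => (hBx y hy).2.1
      · rw [Finset.card_insert_of_notMem fun h => (hBx x h).1 rfl, hBc, Function.update_self]
        have := h0 j
        omega
      · intro y hy z hz hyz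
        rcases Finset.mem_insert.1 hy with rfl | hy' <;> rcases Finset.mem_insert.1 hz with rfl | hz'
        · exact absurd rfl hyz
        · exact (hBx z hz').2.2
        · rw [hc]; exact (hBx y hy').2.2
        · exact hB y hy' z hz' hyz
    · refine ⟨j, B, fun y hy => ?_, by rw [hBc, Function.update_of_ne hij], hB⟩
      exact Finset.mem_of_mem_erase (Finset.mem_filter.1 (hBA hy)).1

/-- For every finite `F` and `s ≥ 1` some complete graph arrows `F`. -/
theorem exists_arrows {V : Type*} [Finite V] (F : SimpleGraph V) {s : ℕ} (hs : 0 < s) :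
    ∃ n : ℕ, Arrows (⊤ : SimpleGraph (Fin n)) s F := by
  classical
  have := Fintype.ofFinite V
  obtain ⟨n, hn⟩ := exists_monochromatic_clique hs _ (fun _ => Fintype.card V) rfl
  refine ⟨n, fun c => ?_⟩
  let c' : Fin n → Fin n → Fin s := fun x y =>
    if h : x ≠ y then c ⟨s(x, y), h⟩ else ⟨0, hs⟩
  have hc' : ∀ x y, c' x y = c' y x := by
    intro x y
    by_cases h : x = y
    · rw [h]
    · simp [c', h, Ne.symm h, Sym2.eq_swap]
  obtain ⟨i, B, -, hBc, hB⟩ := hn c' hc' Finset.univ (by simp)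
  let e : V ≃ B := Fintype.equivOfCardEq (by simp [hBc])
  refine ⟨i, ⟨⟨⟨fun v => (e v : Fin n), fun {u v} huv => ?_⟩, fun u v huv => ?_⟩⟩⟩
  · have hne : (e u : Fin n) ≠ e v := fun h => huv.ne (e.injective (Subtype.ext h))
    rw [SimpleGraph.EdgeLabeling.labelGraph_adj]
    refine ⟨hne, ?_⟩
    have := hB _ (e u).2 _ (e v).2 hne
    simpa [c', hne] using this
  · exact e.injective (Subtype.ext huv)

/-- The degree Ramsey number is attained. -/
theorem exists_arrows_maxDegree_eq {V : Type*} [Finite V] (F : SimpleGraph V) {s : ℕ}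
    (hs : 0 < s) : ∃ (n : ℕ) (H : SimpleGraph (Fin n)) (_ : DecidableRel H.Adj),
      Arrows H s F ∧ H.maxDegree = degreeRamsey F s := by
  classical
  -- Needed because `sInf ∅ = 0` would not be an attained degree.
  have hne : {d : ℕ | ∃ (n : ℕ) (H : SimpleGraph (Fin n)), Arrows H s F ∧
      H.maxDegree = d}.Nonempty := by
    obtain ⟨n, hn⟩ := exists_arrows F hs
    exact ⟨_, n, ⊤, hn, rfl⟩
  obtain ⟨n, H, hH, hd⟩ := Nat.sInf_mem hne
  refine ⟨n, H, inferInstance, hH, ?_⟩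
  unfold degreeRamsey
  convert hd

/-! ### Colouring by random maps into an `𝓛_F`-free graph -/

/-- The spanning subgraph of `H` formed by the edges `uv` which `χ` maps to an edge of `G` and for
which no other neighbour of `u` or `v` receives the colour of `u` or `v`. -/
def pulledBack {W X : Type*} (H : SimpleGraph W) (G : SimpleGraph X) (χ : W → X) :
    SimpleGraph W where
  Adj u v := H.Adj u v ∧ G.Adj (χ u) (χ v) ∧
    ∀ w, H.Adj u w ∨ H.Adj v w → w ≠ u → w ≠ v → χ w ≠ χ u ∧ χ w ≠ χ v
  symm := ⟨fun _ _ h => ⟨h.1.symm, h.2.1.symm, fun w hw h₁ h₂ =>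
    (h.2.2 w hw.symm h₂ h₁).symm⟩⟩
  loopless := ⟨fun _ h => h.1.ne rfl⟩

/-- Two neighbours of a vertex in a copy of `F` get distinct images: each is a further neighbour of
an end of the edge to the other. So copy followed by `χ` is a locally injective map to `G`. -/
theorem not_isContained_pulledBack {V W X : Type*} {F : SimpleGraph V} {G : SimpleGraph X}
    (hG : LocInjFree F G) (H : SimpleGraph W) (χ : W → X) :
    ¬ F.IsContained (pulledBack H G χ) := by
  rintro ⟨f⟩
  refine hG ⊤ ⟨⟨fun v => ⟨χ (f v), trivial⟩, fun {u v} huv => ?_⟩, ?_⟩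
  · exact (f.toHom.map_adj huv).2.1
  · intro v x hx y hy hxy
    have hx' : (pulledBack H G χ).Adj (f v) (f x) := f.toHom.map_adj hx
    have hy' : (pulledBack H G χ).Adj (f v) (f y) := f.toHom.map_adj hy
    by_contra hne
    refine (hx'.2.2 (f y) (Or.inl hy'.1) hy'.1.ne' fun h => hne (f.injective h).symm).2 ?_
    exact (congrArg Subtype.val hxy).symm

open scoped Classical in
/-- A uniformly random map keeps a fixed edge with probability at least `e(G) / n ^ 2`. -/
theorem card_edgeFinset_mul_le_card_pulledBack {W : Type*} [Fintype W] (H : SimpleGraph W)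
    {n D : ℕ} (G : SimpleGraph (Fin n)) (hn : 8 * D ≤ n) (hD : ∀ w, H.degree w < D)
    {u v : W} (huv : H.Adj u v) :
    (G.edgeFinset.card : ℝ) / n ^ 2 * (n : ℝ) ^ Fintype.card W ≤
      (Finset.card {χ : W → Fin n | (pulledBack H G χ).Adj u v} : ℝ) := by
  have hD0 : 0 < D := (Nat.zero_le _).trans_lt (hD u)
  have hn8 : (8 : ℝ) * D ≤ n := by exact_mod_cast hn
  have hD1 : (1 : ℝ) ≤ D := by exact_mod_cast hD0
  have hn0 : (0 : ℝ) < n := by linarith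
  set T : Finset W := H.neighborFinset u ∪ H.neighborFinset v with hT
  have hTc : (T.card : ℝ) ≤ 2 * D := by
    have h := Finset.card_union_le (H.neighborFinset u) (H.neighborFinset v)
    rw [H.card_neighborFinset_eq_degree, H.card_neighborFinset_eq_degree] at h
    have := hD u
    have := hD v
    have hle : T.card ≤ 2 * D := h.trans (by omega)
    exact_mod_cast hle
  -- The box of maps sending `(u, v)` to `q` and the other vertices of `T` away from both values.
  let t : Fin n × Fin n → W → Finset (Fin n) := fun q w =>
    if w = u then {q.1} else if w = v then {q.2} else if w ∈ T then {q.1, q.2}ᶜ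
    else Finset.univ
  have hcard : ∀ q : Fin n × Fin n,
      (n : ℝ) ^ Fintype.card W / (2 * n ^ 2) ≤ ((Fintype.piFinset (t q)).card : ℝ) := by
    intro q
    -- All three factors are at most 1, so their overlap at `u` and `v` is harmless and the product
    -- over `w` splits.
    have hr : ∀ w, (n : ℝ) * ((if w = u then (n : ℝ)⁻¹ else 1) * (if w = v then (n : ℝ)⁻¹ else 1) *
        (if w ∈ T then 1 + (-2 / n : ℝ) else 1)) ≤ ((t q w).card : ℝ) := by
      intro w
      have h2 : 0 ≤ 1 + (-2 / n : ℝ) := by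
        rw [show 1 + (-2 / n : ℝ) = (n - 2) / n by field_simp; ring]
        exact div_nonneg (by linarith) hn0.le
      have h3 : 1 + (-2 / n : ℝ) ≤ 1 := by
        have : (-2 / n : ℝ) ≤ 0 := div_nonpos_of_nonpos_of_nonneg (by norm_num) hn0.le
        linarith
      have h4 : (if w ∈ T then 1 + (-2 / n : ℝ) else 1) ≤ 1 := by split_ifs <;> simp [h3]
      have h4' : 0 ≤ (if w ∈ T then 1 + (-2 / n : ℝ) else 1) := by split_ifs <;> simp [h2]
      have h5 : (n : ℝ)⁻¹ ≤ 1 := inv_le_one_of_one_le₀ (by linarith)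
      have h6 : (n : ℝ) * (n : ℝ)⁻¹ = 1 := mul_inv_cancel₀ hn0.ne'
      have h7 : (0 : ℝ) ≤ (n : ℝ)⁻¹ := by positivity
      by_cases hu : w = u
      · have h8 : (if w = v then (n : ℝ)⁻¹ else 1) ≤ 1 := by split_ifs <;> simp [h5]
        have h9 : (if w = v then (n : ℝ)⁻¹ else 1) * (if w ∈ T then 1 + (-2 / n : ℝ) else 1) ≤ 1 :=
          mul_le_one₀ h8 h4' h4
        simp only [t, if_pos hu, Finset.card_singleton, Nat.cast_one]
        rw [mul_assoc, ← mul_assoc, h6, one_mul]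
        exact h9
      · by_cases hv : w = v
        · simp only [t, if_neg hu, if_pos hv, Finset.card_singleton, Nat.cast_one]
          rw [one_mul, ← mul_assoc, h6, one_mul]
          exact h4
        · by_cases hw : w ∈ T
          · simp only [t, if_neg hu, if_neg hv, if_pos hw, Finset.card_compl, Fintype.card_fin]
            have hle : ({q.1, q.2} : Finset (Fin n)).card ≤ 2 := Finset.card_le_two
            have h10 : (n : ℝ) - 2 ≤
                ((n - ({q.1, q.2} : Finset (Fin n)).card : ℕ) : ℝ) := by
              rw [Nat.cast_sub (by omega)]
              have : (({q.1, q.2} : Finset (Fin n)).card : ℝ) ≤ 2 := by exact_mod_cast hle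
              linarith
            refine le_trans (le_of_eq ?_) h10
            field_simp
            ring
          · simp [t, hu, hv, hw]
    rw [Fintype.card_piFinset, Nat.cast_prod]
    refine le_trans ?_ (Finset.prod_le_prod (fun w _ => ?_) fun w _ => hr w)
    · rw [Finset.prod_mul_distrib, Finset.prod_mul_distrib, Finset.prod_mul_distrib]
      have hT' : ∏ w, (if w ∈ T then 1 + (-2 / n : ℝ) else 1) = (1 + (-2 / n : ℝ)) ^ T.card := by
        simp [Finset.prod_ite_mem]
      rw [hT', Finset.prod_const, Finset.card_univ]
      simp only [Finset.prod_ite_eq', Finset.mem_univ, if_true]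
      -- Bernoulli: `2 * |T| / n ≤ 4 * D / n ≤ 1 / 2`.
      have hb : (1 : ℝ) / 2 ≤ (1 + (-2 / n : ℝ)) ^ T.card := by
        have hge : (-2 : ℝ) ≤ -2 / n := by
          rw [le_div_iff₀ hn0]; nlinarith
        refine le_trans ?_ (one_add_mul_le_pow hge T.card)
        have : (T.card : ℝ) * (-2 / n) = -(2 * T.card / n) := by ring
        rw [this]
        have : 2 * (T.card : ℝ) / n ≤ 1 / 2 := by
          rw [div_le_iff₀ hn0]; linarith
        linarith
      calc (n : ℝ) ^ Fintype.card W / (2 * n ^ 2)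
          = (n : ℝ) ^ Fintype.card W * ((n : ℝ)⁻¹ * (n : ℝ)⁻¹ * (1 / 2)) := by
            field_simp
        _ ≤ _ := by gcongr
    · have h2 : 0 ≤ 1 + (-2 / n : ℝ) := by
        rw [show 1 + (-2 / n : ℝ) = (n - 2) / n by field_simp; ring]
        exact div_nonneg (by linarith) hn0.le
      have h7 : (0 : ℝ) ≤ (n : ℝ)⁻¹ := by positivity
      refine mul_nonneg hn0.le (mul_nonneg (mul_nonneg ?_ ?_) ?_) <;> split_ifs <;>
        first | assumption | exact zero_le_one
  have hsub : ((Finset.univ.filter fun q : Fin n × Fin n => G.Adj q.1 q.2).biUnion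
      fun q => Fintype.piFinset (t q)) ⊆
        ({χ : W → Fin n | (pulledBack H G χ).Adj u v} : Finset (W → Fin n)) := by
    intro χ hχ
    simp only [Finset.mem_biUnion, Finset.mem_filter, Finset.mem_univ, true_and,
      Fintype.mem_piFinset] at hχ ⊢
    obtain ⟨⟨a, b⟩, hab, h⟩ := hχ
    have hu : χ u = a := by simpa [t] using h u
    have hv : χ v = b := by simpa [t, huv.ne'] using h v
    refine ⟨huv, by rw [hu, hv]; exact hab, fun w hw hwu hwv => ?_⟩
    have hwT : w ∈ T := by simpa [hT] using hw
    have := h w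
    simp only [t, if_neg hwu, if_neg hwv, if_pos hwT, Finset.mem_compl, Finset.mem_insert,
      Finset.mem_singleton, not_or] at this
    rwa [hu, hv]
  have hdisj : Set.PairwiseDisjoint
      ((Finset.univ.filter fun q : Fin n × Fin n => G.Adj q.1 q.2 : Finset _) : Set _)
      fun q => Fintype.piFinset (t q) := by
    rintro ⟨a, b⟩ - ⟨a', b'⟩ - hne
    refine Finset.disjoint_left.2 fun χ h h' => hne ?_
    rw [Fintype.mem_piFinset] at h h'
    have hu : χ u = a := by simpa [t] using h u
    have hv : χ v = b := by simpa [t, huv.ne'] using h v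
    have hu' : χ u = a' := by simpa [t] using h' u
    have hv' : χ v = b' := by simpa [t, huv.ne'] using h' v
    rw [← hu, ← hv, ← hu', ← hv']
  have hle := Finset.card_le_card hsub
  rw [Finset.card_biUnion hdisj] at hle
  -- Each edge of `G` gives two ordered pairs, which offsets the lost factor `1 / 2`.
  have h2e : (2 : ℝ) * G.edgeFinset.card =
      ((Finset.univ.filter fun q : Fin n × Fin n => G.Adj q.1 q.2).card : ℝ) := by
    have := G.two_mul_card_edgeFinset
    exact_mod_cast this
  have hsum := Finset.card_nsmul_le_sum
    (Finset.univ.filter fun q : Fin n × Fin n => G.Adj q.1 q.2)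
    (fun q => ((Fintype.piFinset (t q)).card : ℝ)) _ fun q _ => hcard q
  rw [nsmul_eq_mul, ← h2e] at hsum
  calc (G.edgeFinset.card : ℝ) / n ^ 2 * (n : ℝ) ^ Fintype.card W
      = 2 * G.edgeFinset.card * ((n : ℝ) ^ Fintype.card W / (2 * n ^ 2)) := by
        field_simp
    _ ≤ _ := hsum
    _ ≤ _ := by exact_mod_cast hle

open scoped Classical in
/-- The number of `s`-tuples of maps none of which lies in a given set. -/
theorem card_forall_apply {W X : Type*} [Fintype W] [Fintype X] (s : ℕ) (P : (W → X) → Prop) :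
    Finset.card {ω : W → Fin s → X | ∀ i, P fun w => ω w i} =
      (Finset.card {χ : W → X | P χ}) ^ s := by
  rw [show (Finset.card {χ : W → X | P χ}) ^ s =
    (Fintype.piFinset fun _ : Fin s => ({χ : W → X | P χ} : Finset _)).card by
      rw [Fintype.card_piFinset]; simp]
  refine Finset.card_bij' (fun ω _ => Function.swap ω) (fun ω _ => Function.swap ω) ?_ ?_
    (fun _ _ => rfl) (fun _ _ => rfl)
  · intro ω hω
    simp only [Finset.mem_filter, Finset.mem_univ, true_and, Fintype.mem_piFinset] at hω ⊢
    exact hω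
  · intro ω hω
    simp only [Finset.mem_filter, Finset.mem_univ, true_and, Fintype.mem_piFinset] at hω ⊢
    exact hω

/-- If `G` is `𝓛_F`-free and dense enough compared to `s` and `Δ(H)`, the edges of `H` can be
coloured with `s` colours without monochromatic `F`. -/
theorem not_arrows_of_locInjFree {V W : Type*} [Fintype W] {F : SimpleGraph V}
    (H : SimpleGraph W) [DecidableRel H.Adj] {n D s : ℕ} (G : SimpleGraph (Fin n))
    [Fintype G.edgeSet]
    (hG : LocInjFree F G) (hn : 8 * D ≤ n) (hD0 : 0 < D) (hD : ∀ w, H.degree w < D)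
    (hs : 4 * (1 - (G.edgeFinset.card : ℝ) / n ^ 2) ^ s * (D : ℝ) ^ 5 ≤ 1) :
    ¬ Arrows H s F := by
  classical
  have hn0 : (0 : ℝ) < n := by exact_mod_cast (by omega : 0 < n)
  have hp1 : (G.edgeFinset.card : ℝ) / n ^ 2 ≤ 1 := by
    rw [div_le_one (by positivity)]
    have h := G.two_mul_card_edgeFinset
    have h' : 2 * G.edgeFinset.card ≤ n * n := by
      have h'' := Finset.card_le_univ (Finset.univ.filter fun q : Fin n × Fin n => G.Adj q.1 q.2)
      rw [Fintype.card_prod, Fintype.card_fin] at h''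
      calc 2 * G.edgeFinset.card = _ := by convert h
        _ ≤ n * n := h''
    have : (2 : ℝ) * G.edgeFinset.card ≤ n * n := by exact_mod_cast h'
    nlinarith [Nat.cast_nonneg (α := ℝ) G.edgeFinset.card]
  let cn : W → Finset W := fun v => insert v (H.neighborFinset v)
  have hcn : ∀ v, (cn v).card ≤ D := fun v =>
    (Finset.card_insert_le _ _).trans (by
      rw [H.card_neighborFinset_eq_degree]; exact hD v)
  have hcn_self : ∀ v, v ∈ cn v := fun v => Finset.mem_insert_self _ _
  have hcn_adj : ∀ {u v}, H.Adj u v → v ∈ cn u := fun h =>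
    Finset.mem_insert_of_mem (by simpa using h)
  have hcn_symm : ∀ {u v}, v ∈ cn u → u ∈ cn v := by
    intro u v h
    simp only [cn, Finset.mem_insert, SimpleGraph.mem_neighborFinset] at h ⊢
    exact h.imp Eq.symm fun h => h.symm
  -- The bad event that `q` is an edge with no allowed colour; it is empty for non-adjacent pairs.
  obtain ⟨A, hA⟩ : ∃ A : W × W → (W → Fin s → Fin n) → Prop, ∀ q ω, A q ω ↔
      H.Adj q.1 q.2 ∧ ∀ i, ¬ (pulledBack H G fun w => ω w i).Adj q.1 q.2 :=
    ⟨_, fun _ _ => Iff.rfl⟩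
  let T : W × W → Finset W := fun q => cn q.1 ∪ cn q.2
  -- Overlapping supports give a walk `q.1, a, w, b, q'.1, q'.2` of five steps in closed
  -- neighbourhoods of size at most `D`, hence `D ^ 5`.
  let N : W × W → Finset (W × W) := fun q =>
    (cn q.1).biUnion fun a => (cn a).biUnion fun w => (cn w).biUnion fun b =>
      (cn b).biUnion fun x => (cn x).image (Prod.mk x)
  have hAloc : ∀ q (ω ω' : W → Fin s → Fin n), (∀ w ∈ T q, ω w = ω' w) → A q ω → A q ω' := by
    rintro ⟨u, v⟩ ω ω' hωω' hAω
    obtain ⟨hadj, hbad⟩ := (hA _ _).1 hAω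
    refine (hA _ _).2 ⟨hadj, fun i hi => hbad i ⟨hadj, ?_⟩⟩
    have hu : ω u = ω' u := hωω' u (Finset.mem_union_left _ (hcn_self u))
    have hv : ω v = ω' v := hωω' v (Finset.mem_union_right _ (hcn_self v))
    simp only [hu, hv]
    refine ⟨hi.2.1, fun w hw => ?_⟩
    have hw' : ω w = ω' w := hωω' w (hw.elim
      (fun h => Finset.mem_union_left _ (hcn_adj h))
      fun h => Finset.mem_union_right _ (hcn_adj h))
    simp only [hw']
    exact hi.2.2 w hw
  have hTN : ∀ q q' : W × W, H.Adj q.1 q.2 → H.Adj q'.1 q'.2 → ∀ w ∈ T q, w ∈ T q' →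
      q' ∈ N q := by
    intro q q' hq hq' w hw hw'
    have h1 : ∃ a ∈ cn q.1, w ∈ cn a := (Finset.mem_union.1 hw).elim
      (fun h => ⟨q.1, hcn_self _, h⟩) fun h => ⟨q.2, hcn_adj hq, h⟩
    have h2 : ∃ b ∈ cn w, q'.1 ∈ cn b := (Finset.mem_union.1 hw').elim
      (fun h => ⟨q'.1, hcn_symm h, hcn_self _⟩)
      fun h => ⟨q'.2, hcn_symm h, hcn_adj hq'.symm⟩
    obtain ⟨a, ha, hwa⟩ := h1
    obtain ⟨b, hb, hqb⟩ := h2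
    simp only [N, Finset.mem_biUnion, Finset.mem_image]
    exact ⟨a, ha, w, hwa, b, hb, q'.1, hqb, q'.2, hcn_adj hq', rfl⟩
  have hNc : ∀ q, (N q).card ≤ D ^ 5 := by
    intro q
    have key : ∀ (v : W) (f : W → Finset (W × W)) (m : ℕ), (∀ x, (f x).card ≤ m) →
        ((cn v).biUnion f).card ≤ D * m := fun v f m hf =>
      (Finset.card_biUnion_le_card_mul _ _ _ fun x _ => hf x).trans
        (Nat.mul_le_mul_right _ (hcn v))
    have : (N q).card ≤ D * (D * (D * (D * D))) :=
      key _ _ _ fun a => key _ _ _ fun w => key _ _ _ fun b => key _ _ _ fun x =>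
        Finset.card_image_le.trans (hcn x)
    calc (N q).card ≤ _ := this
      _ = D ^ 5 := by ring
  have hprob : ∀ q, H.Adj q.1 q.2 → (Finset.card {ω : W → Fin s → Fin n | A q ω} : ℝ) ≤
      (1 - (G.edgeFinset.card : ℝ) / n ^ 2) ^ s * Fintype.card (W → Fin s → Fin n) := by
    intro q hq
    have h1 : (Finset.card {ω : W → Fin s → Fin n | A q ω} : ℕ) =
        (Finset.card {χ : W → Fin n | ¬ (pulledBack H G χ).Adj q.1 q.2}) ^ s := by
      have h := card_forall_apply s fun χ : W → Fin n => ¬ (pulledBack H G χ).Adj q.1 q.2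
      simp only [hA, hq, true_and]
      convert h
    have h2 : (Finset.card {χ : W → Fin n | ¬ (pulledBack H G χ).Adj q.1 q.2} : ℝ) ≤
        (1 - (G.edgeFinset.card : ℝ) / n ^ 2) * (n : ℝ) ^ Fintype.card W := by
      have hk := card_edgeFinset_mul_le_card_pulledBack (D := D) H G hn
        (fun w => by convert hD w) hq
      have hsplit := Finset.card_filter_add_card_filter_not (s := (Finset.univ : Finset (W → Fin n)))
        (fun χ => (pulledBack H G χ).Adj q.1 q.2)
      rw [Finset.card_univ, Fintype.card_fun, Fintype.card_fin] at hsplit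
      have hsplit' : (Finset.card {χ : W → Fin n | (pulledBack H G χ).Adj q.1 q.2} : ℝ) +
          (Finset.card {χ : W → Fin n | ¬ (pulledBack H G χ).Adj q.1 q.2} : ℝ) =
            (n : ℝ) ^ Fintype.card W := by exact_mod_cast hsplit
      have hk' : (G.edgeFinset.card : ℝ) / n ^ 2 * (n : ℝ) ^ Fintype.card W ≤
        (Finset.card {χ : W → Fin n | (pulledBack H G χ).Adj q.1 q.2} : ℝ) := by convert hk
      linarith
    rw [h1, Nat.cast_pow]
    refine (pow_le_pow_left₀ (Nat.cast_nonneg _) h2 s).trans (le_of_eq ?_)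
    rw [mul_pow, Fintype.card_fun, Fintype.card_fun, Fintype.card_fin, Fintype.card_fin]
    push_cast
    rw [← pow_mul, ← pow_mul, mul_comm s]
  have hne : Nonempty (W → Fin s → Fin n) := ⟨fun _ _ => ⟨0, by omega⟩⟩
  have hindep : ∀ (q : W × W) (S : Finset (W × W)), Disjoint S (N q) →
      (Finset.card {ω : W → Fin s → Fin n | A q ω ∧ ∀ j ∈ S, ¬ A j ω} : ℝ) ≤
        (1 - (G.edgeFinset.card : ℝ) / n ^ 2) ^ s *
          (Finset.card {ω : W → Fin s → Fin n | ∀ j ∈ S, ¬ A j ω} : ℝ) := by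
    intro q S hS
    by_cases hq : H.Adj q.1 q.2
    · have hind := card_and_mul_card_eq (T q) (A q) (fun ω => ∀ j ∈ S, ¬ A j ω) (hAloc q) (by
        intro ω ω' h hω j hj hAj
        refine hω j hj (hAloc j ω' ω (fun w hw => (h w fun hwq => ?_).symm) hAj)
        exact Finset.disjoint_left.1 hS hj (hTN q j hq ((hA _ _).1 hAj).1 w hwq hw))
      have hind' : (Finset.card {ω | A q ω ∧ ∀ j ∈ S, ¬ A j ω} : ℝ) *
          Fintype.card (W → Fin s → Fin n) =
            (Finset.card {ω | A q ω} : ℝ) * (Finset.card {ω | ∀ j ∈ S, ¬ A j ω} : ℝ) := by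
        have h : Finset.card {ω | A q ω ∧ ∀ j ∈ S, ¬ A j ω} * Fintype.card (W → Fin s → Fin n) =
            Finset.card {ω | A q ω} * Finset.card {ω | ∀ j ∈ S, ¬ A j ω} := by convert hind
        exact_mod_cast h
      have hc : (0 : ℝ) < Fintype.card (W → Fin s → Fin n) := by
        exact_mod_cast Fintype.card_pos
      refine le_of_mul_le_mul_right ?_ hc
      rw [hind']
      calc _ ≤ ((1 - (G.edgeFinset.card : ℝ) / n ^ 2) ^ s *
            Fintype.card (W → Fin s → Fin n)) *
              (Finset.card {ω | ∀ j ∈ S, ¬ A j ω} : ℝ) :=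
            mul_le_mul_of_nonneg_right (hprob q hq) (Nat.cast_nonneg _)
        _ = _ := by ring
    · have h0 : (Finset.card {ω | A q ω ∧ ∀ j ∈ S, ¬ A j ω} : ℝ) = 0 := by
        rw [Nat.cast_eq_zero, Finset.card_eq_zero, Finset.filter_eq_empty_iff]
        exact fun ω _ h => hq ((hA _ _).1 h.1).1
      rw [h0]
      exact mul_nonneg (pow_nonneg (by linarith) _) (Nat.cast_nonneg _)
  obtain ⟨ω, hω⟩ := exists_avoid_of_local A N
    ((1 - (G.edgeFinset.card : ℝ) / n ^ 2) ^ s) (D ^ 5)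
    (pow_nonneg (by linarith) _) (by exact_mod_cast hs) (Nat.one_le_pow _ _ hD0) hNc
    (fun q S hS => by convert hindep q S hS)
    Finset.univ
  intro harr
  have hcol : ∀ e : H.edgeSet, ∃ i : Fin s,
      e.1 ∈ (pulledBack H G fun w => ω w i).edgeSet := by
    rintro ⟨e, he⟩
    induction e using Sym2.inductionOn with
    | hf u v =>
      by_contra! h
      exact hω (u, v) (Finset.mem_univ _) ((hA _ _).2 ⟨he, h⟩)
  choose c hc using hcol
  obtain ⟨i, hi⟩ := harr c
  refine not_isContained_pulledBack hG H (fun w => ω w i)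
    (hi.trans (SimpleGraph.IsContained.of_le fun u v huv => ?_))
  obtain ⟨hadj, rfl⟩ := (SimpleGraph.EdgeLabeling.labelGraph_adj (G := H) _ _).1 huv
  exact hc ⟨s(u, v), hadj⟩

/-! ### From the Turán exponent to the Ramsey bound -/

/-- The Turán number is attained when it is positive. -/
theorem exists_locInjFree_card_eq {V : Type*} (F : SimpleGraph V) {n : ℕ}
    (h : 0 < exLocInj F n) :
    ∃ (G : SimpleGraph (Fin n)) (_ : Fintype G.edgeSet), LocInjFree F G ∧
      G.edgeFinset.card = exLocInj F n := by
  classical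
  have hne : (Finset.univ.filter fun G : SimpleGraph (Fin n) => LocInjFree F G).Nonempty := by
    by_contra hempty
    rw [Finset.not_nonempty_iff_eq_empty] at hempty
    refine h.ne' ?_
    unfold exLocInj
    exact (congrArg (Finset.sup · _) (by convert hempty)).trans Finset.sup_empty
  obtain ⟨G, hG, hGe⟩ := Finset.exists_mem_eq_sup _ hne fun G => G.edgeFinset.card
  refine ⟨G, inferInstance, (Finset.mem_filter.1 hG).2, ?_⟩
  rw [← hGe]
  unfold exLocInj
  congr!

/-- If `ex(n, 𝓛_F) = Ω(n ^ (1 + η))`, then `O(D ^ (1 - η) log D)` colours suffice to avoid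
a monochromatic `F` in every graph of maximum degree less than `D`. -/
theorem exists_forall_not_arrows {V : Type*} (F : SimpleGraph V) (η : ℝ)
    (hex : (fun n : ℕ => (n : ℝ) ^ (1 + η)) =O[atTop] (fun n : ℕ => (exLocInj F n : ℝ))) :
    ∃ C : ℝ, 0 < C ∧ ∀ D s : ℕ, 2 ≤ D → C * ((D : ℝ) ^ (1 - η) * Real.log D) ≤ s →
      ∀ (m : ℕ) (H : SimpleGraph (Fin m)) [DecidableRel H.Adj], H.maxDegree < D →
        ¬ Arrows H s F := by
  obtain ⟨a, ha, hbound⟩ := hex.exists_pos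
  obtain ⟨n₀, hn₀⟩ := eventually_atTop.1 hbound.bound
  -- Gives both `n ≥ n₀` and `n ≥ 8 * D`.
  set K : ℕ := n₀ + 8 with hK
  have hK0 : (0 : ℝ) < K := by exact_mod_cast (by omega : 0 < K)
  refine ⟨7 * a * (K : ℝ) ^ (1 - η), by positivity, fun D s hD hs m H _ hH => ?_⟩
  have hD0 : (0 : ℝ) < D := by exact_mod_cast (by omega : 0 < D)
  set n : ℕ := K * D with hn
  have hn0 : (0 : ℝ) < n := by rw [hn, Nat.cast_mul]; positivity
  have hn₀n : n₀ ≤ n := by nlinarith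
  have hexn := hn₀ n hn₀n
  rw [Real.norm_of_nonneg (by positivity), Real.norm_of_nonneg (by positivity)] at hexn
  have hpos : 0 < exLocInj F n := by
    have : (0 : ℝ) < (n : ℝ) ^ (1 + η) := by positivity
    have : (0 : ℝ) < exLocInj F n := pos_of_mul_pos_right (this.trans_le hexn) ha.le
    exact_mod_cast this
  obtain ⟨G, _, hG, hGe⟩ := exists_locInjFree_card_eq F hpos
  refine not_arrows_of_locInjFree (D := D) H G hG (by nlinarith) (by omega)
    (fun w => (H.degree_le_maxDegree w).trans_lt hH) ?_
  rw [hGe]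
  set p : ℝ := (exLocInj F n : ℝ) / n ^ 2 with hp
  have hlog2 : 0 < Real.log 2 := Real.log_pos one_lt_two
  have hlogD : Real.log 2 ≤ Real.log D :=
    Real.log_le_log two_pos (by exact_mod_cast hD)
  have hp_lower : (n : ℝ) ^ (η - 1) ≤ a * p := by
    have : (n : ℝ) ^ (η - 1) = (n : ℝ) ^ (1 + η) / n ^ 2 := by
      rw [← Real.rpow_natCast (n : ℝ) 2, ← Real.rpow_sub hn0]
      congr 1; push_cast; ring
    rw [this, hp, ← mul_div_assoc]
    gcongr
  -- Seven powers of `D`: five for the dependency degree, two to absorb the 4 since `D ≥ 2`.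
  have hps : 7 * Real.log D ≤ p * s := by
    have h1 : 7 * a * ((n : ℝ) ^ (1 - η)) * Real.log D ≤ s := by
      rw [hn, Nat.cast_mul, Real.mul_rpow hK0.le hD0.le]
      linarith
    have h2 : (n : ℝ) ^ (η - 1) * (n : ℝ) ^ (1 - η) = 1 := by
      rw [← Real.rpow_add hn0]; simp
    have h3 : a * (7 * Real.log D) ≤ a * (p * s) := by
      calc a * (7 * Real.log D)
          = (n : ℝ) ^ (η - 1) * (7 * a * ((n : ℝ) ^ (1 - η)) * Real.log D) := by
            linear_combination (-7 * a * Real.log D) * h2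
        _ ≤ (n : ℝ) ^ (η - 1) * s := by gcongr
        _ ≤ a * p * s := by gcongr
        _ = a * (p * s) := by ring
    exact le_of_mul_le_mul_left h3 ha
  have hp1 : p ≤ 1 := by
    rw [hp, div_le_one (by positivity), ← hGe]
    have h := (G.card_edgeFinset_le_card_choose_two).trans (Nat.choose_le_pow _ _)
    rw [Fintype.card_fin] at h
    exact_mod_cast h
  have hpow : (1 - p) ^ s ≤ Real.exp (-(7 * Real.log D)) := by
    calc (1 - p) ^ s ≤ (Real.exp (-p)) ^ s :=
          pow_le_pow_left₀ (by linarith) (Real.one_sub_le_exp_neg p) s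
      _ = Real.exp (-(p * s)) := by rw [← Real.exp_nat_mul]; congr 1; ring
      _ ≤ _ := Real.exp_le_exp.2 (by linarith)
  have hexp : Real.exp (-(7 * Real.log D)) * (D : ℝ) ^ 7 = 1 := by
    rw [Real.exp_neg, show 7 * Real.log D = ((7 : ℕ) : ℝ) * Real.log D by norm_num,
      Real.exp_nat_mul, Real.exp_log hD0]
    exact inv_mul_cancel₀ (by positivity)
  have hD2 : (2 : ℝ) ≤ D := by exact_mod_cast hD
  calc 4 * (1 - p) ^ s * (D : ℝ) ^ 5 ≤ (D : ℝ) ^ 2 * (1 - p) ^ s * (D : ℝ) ^ 5 := by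
        have : (0 : ℝ) ≤ (1 - p) ^ s := pow_nonneg (by linarith) _
        gcongr
        nlinarith
    _ = (1 - p) ^ s * (D : ℝ) ^ 7 := by ring
    _ ≤ Real.exp (-(7 * Real.log D)) * (D : ℝ) ^ 7 := by gcongr
    _ = 1 := hexp

/-- The lower bound for the degree Ramsey number in implicit form. -/
theorem lt_degreeRamsey_rpow_mul_log {V : Type*} [Finite V] (F : SimpleGraph V) (η : ℝ)
    (hex : (fun n : ℕ => (n : ℝ) ^ (1 + η)) =O[atTop] (fun n : ℕ => (exLocInj F n : ℝ))) :
    ∃ C : ℝ, 0 < C ∧ ∀ᶠ s : ℕ in atTop,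
      (s : ℝ) < C * ((3 * degreeRamsey F s : ℝ) ^ (1 - η) * Real.log (3 * degreeRamsey F s)) ∧
        1 ≤ degreeRamsey F s := by
  obtain ⟨C, hC, h⟩ := exists_forall_not_arrows F η hex
  refine ⟨C, hC, ?_⟩
  filter_upwards [eventually_gt_atTop 0,
    tendsto_natCast_atTop_atTop.eventually_ge_atTop
      (C * (((2 : ℕ) : ℝ) ^ (1 - η) * Real.log (2 : ℕ)))] with s hs hs2
  obtain ⟨m, H, _, harr, hdeg⟩ := exists_arrows_maxDegree_eq F hs
  have hR : 1 ≤ degreeRamsey F s := by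
    by_contra! h0
    -- A graph of maximum degree 0 falls under the case `D = 2`.
    exact h 2 s le_rfl hs2 m H (by omega) harr
  refine ⟨?_, hR⟩
  by_contra! hle
  exact h (3 * degreeRamsey F s) s (by omega) (by push_cast; exact hle) m H (by omega) harr

/-- Either `s ≤ x ^ a` already, or `a * log x ≤ log s`, so `log x` may be traded for `log s / a`. -/
theorem div_log_le_of_lt_rpow_mul_log {C a x s : ℝ} (hC : 0 < C) (ha : 0 < a) (hx : 1 ≤ x)
    (hs : Real.exp 1 ≤ s) (h : s < C * (x ^ a * Real.log x)) :
    s / Real.log s ≤ (1 + C / a) * x ^ a := by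
  have hx0 : 0 < x := by linarith
  have hs0 : 0 < s := (Real.exp_pos 1).trans_le hs
  have hlog : 1 ≤ Real.log s := (Real.le_log_iff_exp_le hs0).2 hs
  have hxa : 0 < x ^ a := Real.rpow_pos_of_pos hx0 a
  rcases le_total s (x ^ a) with hle | hle
  · calc s / Real.log s ≤ s := div_le_self hs0.le hlog
      _ ≤ x ^ a := hle
      _ ≤ (1 + C / a) * x ^ a := by
        have : 0 ≤ C / a * x ^ a := by positivity
        linarith
  · have h1 : a * Real.log x ≤ Real.log s := by
      rw [← Real.log_rpow hx0]; exact Real.log_le_log hxa hle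
    rw [div_le_iff₀ (by linarith)]
    have h2 : Real.log x ≤ Real.log s / a := by rw [le_div_iff₀ ha]; linarith
    calc s ≤ C * (x ^ a * Real.log x) := h.le
      _ ≤ C * (x ^ a * (Real.log s / a)) := by gcongr
      _ = C / a * x ^ a * Real.log s := by ring
      _ ≤ (1 + C / a) * x ^ a * Real.log s := by
        have : 0 ≤ x ^ a * Real.log s := by positivity
        nlinarith

end DegreeRamsey

theorem mainTheorem5 {V : Type*} [Finite V] (F : SimpleGraph V) (hF : ¬ F.IsAcyclic) (η : ℝ)
    (hex : (fun n : ℕ => (n : ℝ) ^ (1 + η)) =O[atTop]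
      (fun n : ℕ => (DegreeRamsey.exLocInj F n : ℝ))) :
    (η < 1 →
      (fun s : ℕ => ((s : ℝ) / Real.log s) ^ (1 / (1 - η))) =O[atTop]
        (fun s : ℕ => (DegreeRamsey.degreeRamsey F s : ℝ))) ∧
    (η = 1 →
      ∃ c : ℝ, 0 < c ∧ ∀ᶠ s : ℕ in atTop,
        (2 : ℝ) ^ (c * (s : ℝ) ^ (1 / 4 : ℝ)) ≤ (DegreeRamsey.degreeRamsey F s : ℝ)) := by
  obtain ⟨C, hC, hev⟩ := DegreeRamsey.lt_degreeRamsey_rpow_mul_log F η hex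
  constructor
  · intro hη
    have ha : 0 < 1 - η := by linarith
    refine IsBigO.of_bound ((1 + C / (1 - η)) ^ (1 / (1 - η)) * 3) ?_
    filter_upwards [hev, tendsto_natCast_atTop_atTop.eventually_ge_atTop (Real.exp 1)]
      with s hs hse
    obtain ⟨hlt, hR⟩ := hs
    have hR' : (1 : ℝ) ≤ DegreeRamsey.degreeRamsey F s := by exact_mod_cast hR
    have hs0 : (0 : ℝ) < s := (Real.exp_pos 1).trans_le hse
    have hlog : 1 ≤ Real.log s := (Real.le_log_iff_exp_le hs0).2 hse
    have hdiv : 0 ≤ (s : ℝ) / Real.log s := div_nonneg hs0.le (by linarith)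
    have hmain := DegreeRamsey.div_log_le_of_lt_rpow_mul_log hC ha (by linarith) hse hlt
    rw [Real.norm_of_nonneg (Real.rpow_nonneg hdiv _), Real.norm_of_nonneg (by positivity)]
    calc ((s : ℝ) / Real.log s) ^ (1 / (1 - η))
        ≤ ((1 + C / (1 - η)) *
            (3 * DegreeRamsey.degreeRamsey F s : ℝ) ^ (1 - η)) ^ (1 / (1 - η)) :=
          Real.rpow_le_rpow hdiv hmain (by positivity)
      _ = (1 + C / (1 - η)) ^ (1 / (1 - η)) * (3 * DegreeRamsey.degreeRamsey F s) := by
          rw [Real.mul_rpow (by positivity) (by positivity), ← Real.rpow_mul (by positivity),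
            mul_one_div_cancel ha.ne', Real.rpow_one]
      _ = _ := by ring
  · rintro rfl
    have hlog2 : 0 < Real.log 2 := Real.log_pos one_lt_two
    refine ⟨1 / (2 * C * Real.log 2), by positivity, ?_⟩
    filter_upwards [hev, eventually_ge_atTop 1,
      tendsto_natCast_atTop_atTop.eventually_ge_atTop (2 * C * Real.log 3)] with s hs hs1 hs3
    obtain ⟨hlt, hR⟩ := hs
    have hR' : (1 : ℝ) ≤ DegreeRamsey.degreeRamsey F s := by exact_mod_cast hR
    have hs1' : (1 : ℝ) ≤ s := by exact_mod_cast hs1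
    rw [sub_self, Real.rpow_zero, one_mul, Real.log_mul (by norm_num) (by linarith)] at hlt
    -- The bound `s < C * (log 3 + log R)` is linear in `s`; the fourth root only weakens it.
    have hroot : (s : ℝ) ^ (1 / 4 : ℝ) ≤ s := by
      calc (s : ℝ) ^ (1 / 4 : ℝ) ≤ (s : ℝ) ^ (1 : ℝ) :=
            Real.rpow_le_rpow_of_exponent_le hs1' (by norm_num)
        _ = s := Real.rpow_one _
    rw [Real.rpow_def_of_pos two_pos, ← Real.le_log_iff_exp_le (by linarith)]
    calc Real.log 2 * (1 / (2 * C * Real.log 2) * (s : ℝ) ^ (1 / 4 : ℝ))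
        = (s : ℝ) ^ (1 / 4 : ℝ) / (2 * C) := by field_simp
      _ ≤ s / (2 * C) := by gcongr
      _ ≤ Real.log (DegreeRamsey.degreeRamsey F s) := by
        rw [div_le_iff₀ (by positivity)]
        nlinarith
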